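/- **Setting.** Let $\Omega\subset\mathbb R^n$ ($n\ge 1$) be a bounded Lipschitz domain, $V=H^1(\Omega)$ with $\|u\|_V^2=\|u\|_{L^2(\Omega)}^2+\|\nabla u\|_{L^2(\Omega)}^2$, and write $\|u\|_{L^2(\partial\Omega)}$ for the norm of the trace of $u\in V$. Let $f\in L^2(\Omega)$, $\psi\in H^1(\Omega)$, let $h\in L^2(\partial\Omega)$ be the boundary datum, and let $b_1,\dots,b_n,k\ge0$ be constants. Let $A\colon V\to V^*$ be $$\langle Au,v\rangle=\int_\Omega \nabla u\cdot\nabla v+\sum_{i=1}^n b_i\,\partial_{x_i}u\,v+k\,u\,v ,$$ and let $C_b>0$ satisfy $\|Au-Av\|_{V^*}\le C_b\|u-v\|_V$ for all $u,v\in V$. Put $K=\{u\in V: u\ge\psi\text{ a.e. in }\Omega,\ u=h\text{ on }\partial\Omega\}$ and let $u^*\in K$ be a solution of the variational inequality $\langle Au^*-f,u^*-v\rangle\le0$ for all $v\in K$. For $\gamma>0$ and penalty weights $w_{o_1},w_{o_2},w_{b_1},w_{b_2}\ge0$ define $$L_\gamma(u,v)=\langle Au-f,u-v\rangle-\tfrac1{2\gamma}\|u-v\|_V^2,\qquad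 R_i(u)=w_{b_i}\int_{\partial\Omega}|u-h|^2+w_{o_i}\int_\Omega|(\psi-u)^+|^2 .$$ Given a solution class $\mathcal X^{s}\subset V$ and a non-empty test class $\mathcal X^{t}\subset V$ (for instance sets of neural networks), put $$H_\gamma(u)=\sup_{v\in\mathcal X^{t}}\bigl(L_\gamma(u,v)+R_1(u)-R_2(v)\bigr),\qquad u\in V$$ (a maximum whenever it is attained). Assume that there are $M^s,B^s,M^t,B^t>0$ with $\|u\|_V\le M^s$, $\|u\|_{L^2(\partial\Omega)}\le B^s$ for all $u\in\mathcal X^s$ and $\|v\|_V\le M^t$, $\|v\|_{L^2(\partial\Omega)}\le B^t$ for all $v\in\mathcal X^t$. **Proposition (Estimate on IV).** $H_\gamma$ is finite on $V$, and for all $\bar u\in\mathcal X^s$, $$H_\gamma(\bar u)-H_\gamma(u^*)\le K_4\|\bar u-u^*\|_V+K_5\|\bar u-u^*\|_{L^2(\Omega)}+K_6\|\bar u-u^*\|_{L^2(\partial\Omega)}-w_{b_1}\|\bar u-u^*\|_{L^2(\partial\Omega)}^2-\tfrac1{2\gamma}\|u^*-\bar u\|_V^2,$$ where $$K_4=C_b(M^s+M^t)+\|Au^*-f\|_{V^*}+\tfrac1\gamma(\|u^*\|_V+M^t),\quad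 K_5=w_{o_1}(M^s+\|u^*\|_V+2\|\psi\|_{L^2(\Omega)}),\quad K_6=2w_{b_1}(\|h\|_{L^2(\partial\Omega)}+B^s).$$ **Full error decomposition.** Suppose moreover that $\langle Au-Av,u-v\rangle\ge C_a\|u-v\|_V^2$ for all $u,v\in V$, with $C_a>0$; that $\mathcal X^s,\mathcal X^t\subset C^1(\overline\Omega)$; that $f,\psi$ have representatives continuous on $\Omega$ and $h$ one continuous on $\partial\Omega$; and that $Y\subset V$ is a set with $u^*\in Y$ and $r$ a number with $\|v\|_{L^2(\Omega)}\le r$ for all $v\in K\cap Y$ (for instance, $Y$ the closed ball of radius $r$ in $H^2(\Omega)$, if it contains $u^*$). Let $G_\gamma(u)=\sup_{v\in K\cap Y}L_\gamma(u,v)$. For collocation points $x_1,\dots,x_N\in\Omega$ and $x_1^b,\dots,x_{N_b}^b\in\partial\Omega$ ($N,N_b\ge1$) let $$\hat L(u,v)=\tfrac{|\Omega|}{N}\sum_{i=1}^N\Bigl[\nabla u\cdot(\nabla u-\nabla v)+\sum_{j=1}^n b_j\,\partial_{x_j}u\,(u-v)+k\,u(u-v)-f\,(u-v)\Bigr](x_i),$$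 $$\hat L_\gamma(u,v)=\hat L(u,v)-\tfrac{|\Omega|}{2\gamma N}\sum_{i=1}^N\bigl[(u-v)^2+|\nabla u-\nabla v|^2\bigr](x_i),$$ $$\hat R_i(u)=w_{b_i}\tfrac{|\partial\Omega|}{N_b}\sum_{j=1}^{N_b}(u-h)^2(x_j^b)+w_{o_i}\tfrac{|\Omega|}{N}\sum_{j=1}^N|(\psi-u)^+|^2(x_j),\qquad \hat G_\gamma(u)=\sup_{v\in\mathcal X^t}\bigl(\hat L_\gamma(u,v)+\hat R_1(u)-\hat R_2(v)\bigr).$$ Then $G_\gamma$ is finite on $V$ and $\hat G_\gamma$ is finite on $C^1(\overline\Omega)$. If $\hat u\in\mathcal X^s$ satisfies $\hat G_\gamma(\hat u)\le\hat G_\gamma(u)$ for all $u\in\mathcal X^s$, then for every $\hat u_{\mathcal A}\in\mathcal X^s$ $$\begin{aligned}\Bigl(C_a-\tfrac1{2\gamma}\Bigr)\|\hat u_{\mathcal A}-u^*\|_V^2\le{}&\sup_{v\in K\cap Y}\inf_{w\in\mathcal X^t}\bigl(K_1\|w-v\|_V+K_2\|w-v\|_{L^2(\Omega)}+K_3\|w-v\|_{L^2(\partial\Omega)}\bigr)\\&+\inf_{u\in\mathcal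 X^s}\bigl(K_4\|u-u^*\|_V+K_5\|u-u^*\|_{L^2(\Omega)}+K_6\|u-u^*\|_{L^2(\partial\Omega)}\bigr)\\&+2\sup_{u\in\mathcal X^s,\,v\in\mathcal X^t}\bigl|L_\gamma(u,v)+R_1(u)-R_2(v)-(\hat L_\gamma(u,v)+\hat R_1(u)-\hat R_2(v))\bigr|\\&+\hat G_\gamma(\hat u_{\mathcal A})-\hat G_\gamma(\hat u)+H_\gamma(u^*)-G_\gamma(u^*)+\langle Au^*-f,u^*-\hat u_{\mathcal A}\rangle-R_1(\hat u_{\mathcal A}),\end{aligned}$$ an inequality in $(-\infty,+\infty]$, where $$K_1=C_bM^s+\|f\|_{V^*}+\tfrac1\gamma(M^s+M^t),\quad K_2=w_{o_2}(r+M^t+2\|\psi\|_{L^2(\Omega)}),\quad K_3=2w_{b_2}(\|h\|_{L^2(\partial\Omega)}+B^t).$$ -/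

import Mathlib

open MeasureTheory Filter Topology
open scoped ENNReal RealInnerProductSpace ContDiff

noncomputable section

namespace ObstacleVI

/-- Euclidean space `ℝⁿ`. -/
abbrev Euc (n : ℕ) : Type := EuclideanSpace ℝ (Fin n)

/-- Bounded Lipschitz domain: a nonempty bounded connected open set which, near each boundary
point and in a suitable orthonormal frame with last axis `e`, is the region strictly above the
graph of a Lipschitz function of the coordinates orthogonal to `e`. -/
structure IsBoundedLipschitzDomain {n : ℕ} (Ω : Set (Euc n)) : Prop where
  isOpen : IsOpen Ω
  isConnected : IsConnected Ω
  isBounded : Bornology.IsBounded Ω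
  lipschitz_boundary : ∀ p ∈ frontier Ω, ∃ (e : Euc n) (φ : Euc n → ℝ) (L : NNReal) (ρ : ℝ),
    ‖e‖ = 1 ∧ LipschitzWith L φ ∧ 0 < ρ ∧
      ∀ x ∈ Metric.ball p ρ, x ∈ Ω ↔ φ (x - ⟪e, x⟫ • e) < ⟪e, x⟫

/-- Lebesgue measure on `Ω`. -/
abbrev vol {n : ℕ} (Ω : Set (Euc n)) : Measure (Euc n) := volume.restrict Ω

/-- Surface measure on `∂Ω`: the normalised `(n-1)`-dimensional Hausdorff measure. -/
def surf {n : ℕ} (Ω : Set (Euc n)) : Measure (Euc n) :=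
  (Measure.euclideanHausdorffMeasure (n - 1)).restrict (frontier Ω)

/-- `L²(Ω)`. -/
abbrev L2 {n : ℕ} (Ω : Set (Euc n)) := Lp ℝ 2 (vol Ω)

/-- `L²(Ω; ℝⁿ)`. -/
abbrev L2vec {n : ℕ} (Ω : Set (Euc n)) := Lp (Euc n) 2 (vol Ω)

/-- `L²(∂Ω)`. -/
abbrev L2bd {n : ℕ} (Ω : Set (Euc n)) := Lp ℝ 2 (surf Ω)

/-- Test functions `φ ∈ C_c^∞(Ω)`. -/
structure IsTest {n : ℕ} (Ω : Set (Euc n)) (φ : Euc n → ℝ) : Prop where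
  smooth : ContDiff ℝ ∞ φ
  compact : HasCompactSupport φ
  supp : tsupport φ ⊆ Ω

/-- `g` is the weak gradient of `u` on `Ω`: `∫_Ω u ∂_y φ = -∫_Ω (g · y) φ` for all test
functions `φ` and all directions `y`. -/
def IsWeakGradient {n : ℕ} (Ω : Set (Euc n)) (u : Euc n → ℝ) (g : Euc n → Euc n) : Prop :=
  ∀ φ : Euc n → ℝ, IsTest Ω φ → ∀ y : Euc n,
    ∫ x in Ω, u x * fderiv ℝ φ x y = -∫ x in Ω, ⟪g x, y⟫ * φ x

theorem IsTest.memLp {n : ℕ} {Ω : Set (Euc n)} {φ : Euc n → ℝ} (hφ : IsTest Ω φ) :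
    MemLp φ 2 (vol Ω) :=
  (hφ.smooth.continuous.memLp_of_hasCompactSupport hφ.compact).restrict _

theorem IsTest.memLp_fderiv {n : ℕ} {Ω : Set (Euc n)} {φ : Euc n → ℝ} (hφ : IsTest Ω φ)
    (y : Euc n) : MemLp (fun x => fderiv ℝ φ x y) 2 (vol Ω) := by
  have hc : Continuous (fun x => fderiv ℝ φ x y) :=
    (hφ.smooth.continuous_fderiv (by simp)).clm_apply continuous_const
  exact (hc.memLp_of_hasCompactSupport (hφ.compact.fderiv_apply ℝ y)).restrict _

/-- The Sobolev space `V = H¹(Ω)`, realised as the space of all pairs `(u, ∇u)` of an `L²`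
function and its `L²` weak gradient (which is unique), with the Hilbert norm
`‖u‖_V² = ‖u‖²_{L²(Ω)} + ‖∇u‖²_{L²(Ω)}`. -/
def H1 {n : ℕ} (Ω : Set (Euc n)) : Submodule ℝ (WithLp 2 (L2 Ω × L2vec Ω)) where
  carrier := {w | IsWeakGradient Ω w.fst w.snd}
  zero_mem' := by
    intro φ hφ y
    have h1 : ∫ x in Ω, ((0 : L2 Ω) : Euc n → ℝ) x * fderiv ℝ φ x y = 0 := by
      refine integral_eq_zero_of_ae ?_
      filter_upwards [Lp.coeFn_zero ℝ 2 (vol Ω)] with x hx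
      rw [hx]; simp
    have h2 : ∫ x in Ω, ⟪((0 : L2vec Ω) : Euc n → Euc n) x, y⟫ * φ x = 0 := by
      refine integral_eq_zero_of_ae ?_
      filter_upwards [Lp.coeFn_zero (Euc n) 2 (vol Ω)] with x hx
      rw [hx]; simp
    simp only [WithLp.zero_fst, WithLp.zero_snd]
    rw [h1, h2, neg_zero]
  add_mem' := by
    intro v w hv hw φ hφ y
    have e1 : ∫ x in Ω, (v + w).fst x * fderiv ℝ φ x y
        = ∫ x in Ω, (v.fst x * fderiv ℝ φ x y + w.fst x * fderiv ℝ φ x y) := by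
      refine integral_congr_ae ?_
      filter_upwards [Lp.coeFn_add v.fst w.fst] with x hx
      simp only [WithLp.add_fst, hx, Pi.add_apply, add_mul]
    have e2 : ∫ x in Ω, ⟪(v + w).snd x, y⟫ * φ x
        = ∫ x in Ω, (⟪v.snd x, y⟫ * φ x + ⟪w.snd x, y⟫ * φ x) := by
      refine integral_congr_ae ?_
      filter_upwards [Lp.coeFn_add v.snd w.snd] with x hx
      simp only [WithLp.add_snd, hx, Pi.add_apply, inner_add_left, add_mul]
    have i1 : ∀ z : L2 Ω, Integrable (fun x => z x * fderiv ℝ φ x y) (vol Ω) := fun z =>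
      (Lp.memLp z).integrable_mul (hφ.memLp_fderiv y)
    have i2 : ∀ z : L2vec Ω, Integrable (fun x => ⟪z x, y⟫ * φ x) (vol Ω) := fun z =>
      ((Lp.memLp z).inner_const y).integrable_mul hφ.memLp
    rw [e1, e2, integral_add (i1 _) (i1 _), integral_add (i2 _) (i2 _), hv φ hφ y, hw φ hφ y]
    ring
  smul_mem' := by
    intro c w hw φ hφ y
    have e1 : ∫ x in Ω, (c • w).fst x * fderiv ℝ φ x y
        = ∫ x in Ω, c * (w.fst x * fderiv ℝ φ x y) := by
      refine integral_congr_ae ?_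
      filter_upwards [Lp.coeFn_smul c w.fst] with x hx
      simp only [WithLp.smul_fst, hx, Pi.smul_apply, smul_eq_mul, mul_assoc]
    have e2 : ∫ x in Ω, ⟪(c • w).snd x, y⟫ * φ x
        = ∫ x in Ω, c * (⟪w.snd x, y⟫ * φ x) := by
      refine integral_congr_ae ?_
      filter_upwards [Lp.coeFn_smul c w.snd] with x hx
      simp only [WithLp.smul_snd, hx, Pi.smul_apply, real_inner_smul_left, mul_assoc]
    rw [e1, e2, integral_const_mul, integral_const_mul, hw φ hφ y]
    ring

/-- The embedding `H¹(Ω) → L²(Ω)`. -/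
def val {n : ℕ} {Ω : Set (Euc n)} : H1 Ω →L[ℝ] L2 Ω :=
  (WithLp.fstL 2 ℝ (L2 Ω) (L2vec Ω)).comp (H1 Ω).subtypeL

/-- The weak gradient `H¹(Ω) → L²(Ω; ℝⁿ)`. -/
def grad {n : ℕ} {Ω : Set (Euc n)} : H1 Ω →L[ℝ] L2vec Ω :=
  (WithLp.sndL 2 ℝ (L2 Ω) (L2vec Ω)).comp (H1 Ω).subtypeL

theorem norm_sq_H1 {n : ℕ} {Ω : Set (Euc n)} (u : H1 Ω) :
    ‖u‖ ^ 2 = ‖val u‖ ^ 2 + ‖grad u‖ ^ 2 :=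
  WithLp.prod_norm_sq_eq_of_L2 (u : WithLp 2 (L2 Ω × L2vec Ω))

/-- `g ∈ L²(∂Ω)` is the boundary trace of `u ∈ H¹(Ω)`: there are `C¹` functions `φ_k` on `ℝⁿ`
with `φ_k|_Ω → u` in `H¹(Ω)` and `φ_k|_{∂Ω} → g` in `L²(∂Ω)`. -/
def IsTrace {n : ℕ} {Ω : Set (Euc n)} (u : H1 Ω) (g : L2bd Ω) : Prop :=
  ∃ (w : ℕ → H1 Ω) (φ : ℕ → Euc n → ℝ),
    (∀ j, ContDiff ℝ 1 (φ j)) ∧ (∀ j, val (w j) =ᵐ[vol Ω] φ j) ∧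
    Tendsto w atTop (𝓝 u) ∧
    Tendsto (fun j => eLpNorm (fun x => φ j x - g x) 2 (surf Ω)) atTop (𝓝 0)

open Classical in
/-- The trace operator `H¹(Ω) → L²(∂Ω)`. On a bounded Lipschitz domain the trace exists and is
unique for every `u`, so that the default value is never used there. -/
def trace {n : ℕ} {Ω : Set (Euc n)} (u : H1 Ω) : L2bd Ω :=
  if hu : ∃ g, IsTrace u g then hu.choose else 0

/-- The space `C¹(Ω̄)`: functions which are differentiable in `Ω` and continuous, together
with their gradient, up to the boundary. -/
structure C1Closure {n : ℕ} (Ω : Set (Euc n)) where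
  toFun : Euc n → ℝ
  gradient : Euc n → Euc n
  continuousOn_toFun : ContinuousOn toFun (closure Ω)
  continuousOn_gradient : ContinuousOn gradient (closure Ω)
  hasGradientAt : ∀ x ∈ Ω, HasGradientAt toFun (gradient x) x

theorem memLp_of_continuousOn_closure {n : ℕ} {F : Type*} [NormedAddCommGroup F]
    {Ω : Set (Euc n)} (ho : IsOpen Ω) (hb : Bornology.IsBounded Ω) {u : Euc n → F}
    [SecondCountableTopology F]
    (hu : ContinuousOn u (closure Ω)) : MemLp u 2 (vol Ω) := by
  obtain ⟨C, hC⟩ := hb.isCompact_closure.exists_bound_of_continuousOn hu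
  have : IsFiniteMeasure (vol Ω) := ⟨by simpa using hb.measure_lt_top⟩
  refine MemLp.of_bound ((hu.mono subset_closure).aestronglyMeasurable ho.measurableSet) C ?_
  filter_upwards [ae_restrict_mem ho.measurableSet] with x hx using hC x (subset_closure hx)

/-- On a bounded open set the classical gradient of a `C¹(Ω̄)` function is its weak gradient. -/
theorem C1Closure.isWeakGradient {n : ℕ} {Ω : Set (Euc n)} (ho : IsOpen Ω)
    (hb : Bornology.IsBounded Ω) (u : C1Closure Ω) :
    IsWeakGradient Ω u.toFun u.gradient := by
  intro φ hφ y
  have hu2 := memLp_of_continuousOn_closure ho hb u.continuousOn_toFun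
  have hg2 := memLp_of_continuousOn_closure ho hb u.continuousOn_gradient
  have i1 : Integrable (fun x => u.toFun x * fderiv ℝ φ x y) (vol Ω) :=
    hu2.integrable_mul (hφ.memLp_fderiv y)
  have i2 : Integrable (fun x => ⟪u.gradient x, y⟫ * φ x) (vol Ω) :=
    (hg2.inner_const y).integrable_mul hφ.memLp
  set p : Euc n → ℝ := fun x => u.toFun x * φ x with hp
  have hφ0 : ∀ x, x ∉ Ω → φ x = 0 := fun x hx =>
    image_eq_zero_of_notMem_tsupport fun h => hx (hφ.supp h)
  have hdφ0 : ∀ x, x ∉ Ω → fderiv ℝ φ x = 0 := fun x hx => by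
    by_contra h
    exact hx (hφ.supp (support_fderiv_subset ℝ h))
  have hd : ∀ x, HasFDerivAt p
      (u.toFun x • fderiv ℝ φ x + φ x • (InnerProductSpace.toDual ℝ (Euc n) (u.gradient x))) x := by
    intro x
    by_cases hx : x ∈ Ω
    · exact (u.hasGradientAt x hx).hasFDerivAt.mul
        (hφ.smooth.differentiable (by simp) x).hasFDerivAt
    · have hx' : x ∉ tsupport φ := fun h => hx (hφ.supp h)
      have hz : p =ᶠ[𝓝 x] fun _ => 0 := by
        filter_upwards [(isClosed_tsupport φ).isOpen_compl.mem_nhds hx'] with z hz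
        simp [hp, image_eq_zero_of_notMem_tsupport hz]
      rw [hφ0 x hx, hdφ0 x hx]
      simpa using (hasFDerivAt_const (0 : ℝ) x).congr_of_eventuallyEq hz
  have hfd : ∀ x, fderiv ℝ p x y = u.toFun x * fderiv ℝ φ x y + ⟪u.gradient x, y⟫ * φ x := by
    intro x
    rw [(hd x).fderiv]
    simp [mul_comm]
  have hoff : ∀ x, x ∉ Ω → fderiv ℝ p x y = 0 := fun x hx => by
    rw [hfd, hφ0 x hx, hdφ0 x hx]; simp
  have ip : Integrable (fun x => fderiv ℝ p x y) volume := by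
    rw [← integrableOn_iff_integrable_of_support_subset (s := Ω)
      (fun x hx => by_contra fun h => hx (hoff x h))]
    exact (i1.add i2).congr (ae_of_all _ fun x => (hfd x).symm)
  have ip0 : Integrable p volume := by
    rw [← integrableOn_iff_integrable_of_support_subset (s := Ω)
      (fun x hx => by_contra fun h => hx (by simp [hp, hφ0 x h]))]
    exact hu2.integrable_mul hφ.memLp
  have hz : ∫ x, fderiv ℝ p x y = 0 := by
    have := integral_mul_fderiv_eq_neg_fderiv_mul_of_integrable (μ := (volume : Measure (Euc n)))
      (f := fun _ : Euc n => (1 : ℝ)) (g := p) (v := y) (by simp)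
      (by simpa using ip) (by simpa using ip0) (fun _ _ => differentiableAt_const _)
      (fun x _ => (hd x).differentiableAt)
    simpa using this
  rw [← setIntegral_eq_integral_of_forall_compl_eq_zero (s := Ω) (fun x hx => hoff x hx)] at hz
  simp only [hfd] at hz
  rw [integral_add i1 i2] at hz
  linarith

/-- The embedding `C¹(Ω̄) ⊂ H¹(Ω)`. -/
def C1Closure.toH1 {n : ℕ} {Ω : Set (Euc n)} (hΩ : IsBoundedLipschitzDomain Ω)
    (u : C1Closure Ω) : H1 Ω :=
  ⟨WithLp.toLp 2
    ((memLp_of_continuousOn_closure hΩ.isOpen hΩ.isBounded u.continuousOn_toFun).toLp u.toFun,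
     (memLp_of_continuousOn_closure hΩ.isOpen hΩ.isBounded u.continuousOn_gradient).toLp
        u.gradient), by
    intro φ hφ y
    have h1 := (memLp_of_continuousOn_closure hΩ.isOpen hΩ.isBounded
      u.continuousOn_toFun).coeFn_toLp
    have h2 := (memLp_of_continuousOn_closure hΩ.isOpen hΩ.isBounded
      u.continuousOn_gradient).coeFn_toLp
    have h := C1Closure.isWeakGradient hΩ.isOpen hΩ.isBounded u φ hφ y
    refine Eq.trans (integral_congr_ae ?_) (h.trans (congrArg Neg.neg (integral_congr_ae ?_)))
    · filter_upwards [h1] with x hx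
      simp only [WithLp.toLp_fst, hx]
    · filter_upwards [h2] with x hx
      simp only [WithLp.toLp_snd, hx]⟩

/-- The data of the obstacle problem and of its penalised minmax formulation. -/
structure ProblemData {n : ℕ} (Ω : Set (Euc n)) where
  /-- transport coefficients -/
  b : Euc n
  /-- zeroth-order coefficient -/
  k : ℝ
  /-- source term -/
  f : L2 Ω
  /-- obstacle -/
  ψ : H1 Ω
  /-- Dirichlet datum -/
  h : L2bd Ω
  /-- regularisation parameter -/
  γ : ℝ
  /-- penalty weights for the obstacle and boundary constraints on `u` and on `v` -/
  wo₁ : ℝ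
  wb₁ : ℝ
  wo₂ : ℝ
  wb₂ : ℝ
  b_nonneg : ∀ i, 0 ≤ b i
  k_nonneg : 0 ≤ k
  γ_pos : 0 < γ
  wo₁_nonneg : 0 ≤ wo₁
  wb₁_nonneg : 0 ≤ wb₁
  wo₂_nonneg : 0 ≤ wo₂
  wb₂_nonneg : 0 ≤ wb₂

namespace ProblemData

variable {n : ℕ} {Ω : Set (Euc n)} (P : ProblemData Ω)

/-- The operator `A = -Δ + ∑ bᵢ ∂ᵢ + k Id : V → V*`. -/
def A (u : H1 Ω) : StrongDual ℝ (H1 Ω) :=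
  (innerSL ℝ (grad u)).comp grad +
    (innerSL ℝ ((innerSL ℝ P.b).compLp (grad u) + P.k • val u)).comp val

theorem A_apply (u v : H1 Ω) :
    P.A u v = ∫ x in Ω, (⟪grad u x, grad v x⟫ + (∑ i, P.b i * grad u x i) * val v x
      + P.k * val u x * val v x) := by
  have h1 : P.A u v = (∫ x in Ω, ⟪grad u x, grad v x⟫)
      + ∫ x in Ω, ⟪((innerSL ℝ P.b).compLp (grad u) + P.k • val u) x, val v x⟫ := rfl
  rw [h1, ← integral_add (L2.integrable_inner _ _) (L2.integrable_inner _ _)]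
  refine integral_congr_ae ?_
  filter_upwards [Lp.coeFn_add ((innerSL ℝ P.b).compLp (grad u)) (P.k • val u),
    Lp.coeFn_smul P.k (val u), (innerSL ℝ P.b).coeFn_compLp (grad u)] with x h1 h2 h3
  simp only [h1, Pi.add_apply, h2, h3, Pi.smul_apply, innerSL_apply_apply, smul_eq_mul,
    PiLp.inner_apply, RCLike.inner_apply, conj_trivial]
  rw [show ∑ i, grad u x i * P.b i = ∑ i, P.b i * grad u x i from
    Finset.sum_congr rfl fun i _ => mul_comm _ _]
  ring

/-- The source `f ∈ L²(Ω)` as an element of `V*`. -/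
def load : StrongDual ℝ (H1 Ω) := (innerSL ℝ P.f).comp val

/-- The feasible set `K = {u ∈ V : u ≥ ψ in Ω, u = h on ∂Ω}`. -/
def K : Set (H1 Ω) := {u | (∀ᵐ x ∂(vol Ω), val P.ψ x ≤ val u x) ∧ trace u = P.h}

/-- `u ∈ K` and `⟨Au - f, u - v⟩ ≤ 0` for all `v ∈ K`. -/
def SolvesVI (u : H1 Ω) : Prop := u ∈ P.K ∧ ∀ v ∈ P.K, (P.A u - P.load) (u - v) ≤ 0

/-- `L_γ(u,v) = ⟨Au - f, u - v⟩ - ‖u - v‖_V² / (2γ)`. -/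
def Lγ (u v : H1 Ω) : ℝ := (P.A u - P.load) (u - v) - 1 / (2 * P.γ) * ‖u - v‖ ^ 2

/-- Obstacle loss. -/
def Lo (u : H1 Ω) : ℝ := ∫ x in Ω, max (val P.ψ x - val u x) 0 ^ 2

/-- Boundary loss. -/
def Lb (u : H1 Ω) : ℝ := ∫ x, (trace u x - P.h x) ^ 2 ∂(surf Ω)

def R₁ (u : H1 Ω) : ℝ := P.wb₁ * P.Lb u + P.wo₁ * P.Lo u

def R₂ (v : H1 Ω) : ℝ := P.wb₂ * P.Lb v + P.wo₂ * P.Lo v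

/-- The generalised regularised gap function `G_γ(u) = sup_{v ∈ K ∩ Y} L_γ(u,v)`. -/
def G (Y : Set (H1 Ω)) (u : H1 Ω) : ℝ := ⨆ v : (P.K ∩ Y : Set (H1 Ω)), P.Lγ u v

/-- `H_γ(u) = sup_{v ∈ X^t} (L_γ(u,v) + R₁(u) - R₂(v))`. -/
def H (Xt : Set (H1 Ω)) (u : H1 Ω) : ℝ := ⨆ v : Xt, (P.Lγ u v + P.R₁ u - P.R₂ v)

/-! The constants of the estimates. -/

def K₁ (Cb Ms Mt : ℝ) : ℝ := Cb * Ms + ‖P.load‖ + 1 / P.γ * (Ms + Mt)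

def K₂ (r Mt : ℝ) : ℝ := P.wo₂ * (r + Mt + 2 * ‖val P.ψ‖)

def K₃ (Bt : ℝ) : ℝ := 2 * P.wb₂ * (‖P.h‖ + Bt)

def K₄ (Cb Ms Mt : ℝ) (ustar : H1 Ω) : ℝ :=
  Cb * (Ms + Mt) + ‖P.A ustar - P.load‖ + 1 / P.γ * (‖ustar‖ + Mt)

def K₅ (Ms : ℝ) (ustar : H1 Ω) : ℝ := P.wo₁ * (Ms + ‖ustar‖ + 2 * ‖val P.ψ‖)

def K₆ (Bs : ℝ) : ℝ := P.wb₁ * 2 * (‖P.h‖ + Bs)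

end ProblemData

/-- `‖u‖_V ≤ M` and `‖u‖_{L²(∂Ω)} ≤ B` for all `u ∈ X`. -/
def UniformBound {n : ℕ} {Ω : Set (Euc n)} (X : Set (H1 Ω)) (M B : ℝ) : Prop :=
  ∀ u ∈ X, ‖u‖ ≤ M ∧ ‖trace u‖ ≤ B

/-- Collocation points in `Ω` and on `∂Ω`, and the continuous representatives of `f`, `ψ` and
`h` that are evaluated there. -/
structure Collocation {n : ℕ} {Ω : Set (Euc n)} (P : ProblemData Ω) where
  N : ℕ
  Nb : ℕ
  N_pos : 0 < N
  Nb_pos : 0 < Nb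
  x : Fin N → Euc n
  xb : Fin Nb → Euc n
  x_mem : ∀ i, x i ∈ Ω
  xb_mem : ∀ i, xb i ∈ frontier Ω
  f : Euc n → ℝ
  ψ : Euc n → ℝ
  h : Euc n → ℝ
  f_cont : ContinuousOn f Ω
  ψ_cont : ContinuousOn ψ Ω
  h_cont : ContinuousOn h (frontier Ω)
  f_ae : P.f =ᵐ[vol Ω] f
  ψ_ae : val P.ψ =ᵐ[vol Ω] ψ
  h_ae : P.h =ᵐ[surf Ω] h

namespace Collocation

variable {n : ℕ} {Ω : Set (Euc n)} {P : ProblemData Ω} (D : Collocation P)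

/-- The discrete version of `L`. -/
def hatL (u v : C1Closure Ω) : ℝ :=
  volume.real Ω / D.N * ∑ i, (⟪u.gradient (D.x i), u.gradient (D.x i) - v.gradient (D.x i)⟫
      + (∑ j, P.b j * u.gradient (D.x i) j) * (u.toFun (D.x i) - v.toFun (D.x i))
      + P.k * u.toFun (D.x i) * (u.toFun (D.x i) - v.toFun (D.x i)))
    - volume.real Ω / D.N * ∑ i, D.f (D.x i) * (u.toFun (D.x i) - v.toFun (D.x i))

/-- The discrete version of `L_γ`. -/
def hatLγ (u v : C1Closure Ω) : ℝ :=
  D.hatL u v - volume.real Ω / (2 * P.γ * D.N) *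
    ∑ i, ((u.toFun (D.x i) - v.toFun (D.x i)) ^ 2
      + ‖u.gradient (D.x i) - v.gradient (D.x i)‖ ^ 2)

/-- The discrete obstacle loss. -/
def hatLo (u : C1Closure Ω) : ℝ :=
  volume.real Ω / D.N * ∑ i, max (D.ψ (D.x i) - u.toFun (D.x i)) 0 ^ 2

/-- The discrete boundary loss. -/
def hatLb (u : C1Closure Ω) : ℝ :=
  (surf Ω).real Set.univ / D.Nb * ∑ i, (u.toFun (D.xb i) - D.h (D.xb i)) ^ 2

def hatR₁ (u : C1Closure Ω) : ℝ := P.wb₁ * D.hatLb u + P.wo₁ * D.hatLo u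

def hatR₂ (v : C1Closure Ω) : ℝ := P.wb₂ * D.hatLb v + P.wo₂ * D.hatLo v

/-- The discrete gap function
`Ĝ_γ(u) = sup_{v ∈ X^t} (L̂_γ(u,v) + R̂₁(u) - R̂₂(v))`. -/
def hatG (Xt : Set (C1Closure Ω)) (u : C1Closure Ω) : ℝ :=
  ⨆ v : Xt, (D.hatLγ u v + D.hatR₁ u - D.hatR₂ v)

end Collocation

end ObstacleVI

end

open ObstacleVI

namespace ObstacleVI

namespace ProblemData

variable {n : ℕ} {Ω : Set (Euc n)} (P : ProblemData Ω)

/-! All suprema are finite because a term linear in `‖u - v‖` minus `‖u - v‖ ^ 2 / (2γ)` is bounded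
above independently of `v` (`linear_sub_sq_le`), and the penalties in `v` only lower the value. The
estimate on `H` compares the two suprema at the same `v`, so that `R₂ v` cancels. `Lγ_sub_left_le`
bounds the change of `Lγ`, `R₁` vanishes at the feasible `ustar`, and `R₁_le` makes `R₁ u` small
when `u` is near `ustar`. For the decomposition, coercivity bounds the squared error by `G uA` plus
the residual of the inequality at `ustar`, while `G ustar = 0`. Replacing each `v ∈ K ∩ Y` by a test
function `w` costs the approximation error of the test class, by `Lγ_sub_right_le` and `R₂_le`, and
leads to `H uA - R₁ uA`. The chain `H uA → hatG uA → hatG uhat ≤ hatG u → H u → H ustar` then pays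
the quadrature error twice, the optimisation gap once and the approximation error of an arbitrary `u
∈ Xs` once. -/

theorem A_zero : P.A 0 = 0 := by
  ext v
  have h0 : (innerSL ℝ P.b).compLp (0 : L2vec Ω) = 0 :=
    ((innerSL ℝ P.b).compLpL 2 (vol Ω)).map_zero
  simp [A, h0]

/-! ### Penalty terms and feasible points -/

theorem norm_val_le (u : H1 Ω) : ‖val u‖ ≤ ‖u‖ := by
  have h := norm_sq_H1 u
  exact abs_le_of_sq_le_sq' (by nlinarith [sq_nonneg ‖grad u‖]) (norm_nonneg _) |>.2

theorem integral_sq_sub_eq_norm_sq {α : Type*} [MeasurableSpace α] {μ : Measure α}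
    (f g : Lp ℝ 2 μ) : ∫ x, (f x - g x) ^ 2 ∂μ = ‖f - g‖ ^ 2 := by
  rw [← real_inner_self_eq_norm_sq, L2.inner_def]
  refine integral_congr_ae ?_
  filter_upwards [Lp.coeFn_sub f g] with x hx
  rw [hx, Pi.sub_apply, real_inner_self_eq_norm_sq, Real.norm_eq_abs, sq_abs]

theorem Lb_eq (u : H1 Ω) : P.Lb u = ‖trace u - P.h‖ ^ 2 :=
  integral_sq_sub_eq_norm_sq _ _

theorem Lo_nonneg (u : H1 Ω) : 0 ≤ P.Lo u :=
  integral_nonneg fun _ => sq_nonneg _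

/-- The obstacle loss is controlled by the distance to any function above the obstacle. -/
theorem Lo_le {v : H1 Ω} (hv : ∀ᵐ x ∂(vol Ω), val P.ψ x ≤ val v x) (u : H1 Ω) :
    P.Lo u ≤ ‖val (u - v)‖ ^ 2 := by
  rw [map_sub, ← integral_sq_sub_eq_norm_sq]
  have hi : Integrable (fun x => (val u x - val v x) ^ 2) (vol Ω) :=
    ((Lp.memLp (val u)).sub (Lp.memLp (val v))).integrable_sq
  refine integral_mono_of_nonneg (ae_of_all _ fun _ => sq_nonneg _) hi ?_
  filter_upwards [hv] with x hx
  rw [← sq_abs (val u x - val v x)]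
  -- Since `ψ ≤ v`, pointwise `(ψ - u)⁺ ≤ (v - u)⁺ ≤ |u - v|`.
  refine pow_le_pow_left₀ (le_max_right _ _) (max_le ?_ (abs_nonneg _)) 2
  linarith [neg_abs_le (val u x - val v x)]

theorem R₁_nonneg (u : H1 Ω) : 0 ≤ P.R₁ u := by
  rw [R₁, Lb_eq]
  have := P.wb₁_nonneg
  have := P.wo₁_nonneg
  have := P.Lo_nonneg u
  positivity

theorem R₂_nonneg (u : H1 Ω) : 0 ≤ P.R₂ u := by
  rw [R₂, Lb_eq]
  have := P.wb₂_nonneg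
  have := P.wo₂_nonneg
  have := P.Lo_nonneg u
  positivity

/-- A weighted penalty `wb * Lb + wo * Lo` at `u`, bounded in terms of the distance to `v ∈ K`. -/
theorem penalty_le (wb : ℝ) {wo : ℝ} (hwo : 0 ≤ wo) {v : H1 Ω} (hv : v ∈ P.K)
    (u : H1 Ω) :
    wb * P.Lb u + wo * P.Lo u ≤
      wb * ‖trace u - trace v‖ ^ 2 + wo * ‖val (u - v)‖ ^ 2 := by
  rw [Lb_eq, hv.2]
  gcongr
  exact P.Lo_le hv.1 u

theorem R₁_eq_zero {v : H1 Ω} (hv : v ∈ P.K) : P.R₁ v = 0 := by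
  refine le_antisymm ?_ (P.R₁_nonneg v)
  simpa [R₁] using P.penalty_le P.wb₁ P.wo₁_nonneg hv v

/-! ### Finiteness of the continuous gap functions -/

/-- Completing the square. The bound is free of `t`, hence later of the test function. -/
theorem linear_sub_sq_le {γ : ℝ} (hγ : 0 < γ) (a t : ℝ) :
    a * t - 1 / (2 * γ) * t ^ 2 ≤ γ / 2 * a ^ 2 := by
  have h : γ / 2 * a ^ 2 - (a * t - 1 / (2 * γ) * t ^ 2) = (γ * a - t) ^ 2 / (2 * γ) := by
    field_simp
    ring
  have : 0 ≤ (γ * a - t) ^ 2 / (2 * γ) := by positivity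
  linarith

theorem Lγ_le (u v : H1 Ω) : P.Lγ u v ≤ P.γ / 2 * ‖P.A u - P.load‖ ^ 2 := by
  have h1 := (le_abs_self _).trans ((P.A u - P.load).le_opNorm (u - v))
  have h2 := linear_sub_sq_le P.γ_pos ‖P.A u - P.load‖ ‖u - v‖
  rw [Lγ]
  linarith

theorem bddAbove_Lγ (S : Set (H1 Ω)) (u : H1 Ω) :
    BddAbove (Set.range fun v : S => P.Lγ u v) :=
  ⟨_, Set.forall_mem_range.2 fun v => P.Lγ_le u v⟩

theorem bddAbove_H (Xt : Set (H1 Ω)) (u : H1 Ω) :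
    BddAbove (Set.range fun v : Xt => P.Lγ u v + P.R₁ u - P.R₂ v) :=
  ⟨P.γ / 2 * ‖P.A u - P.load‖ ^ 2 + P.R₁ u, Set.forall_mem_range.2 fun v => by
    linarith [P.Lγ_le u v, P.R₂_nonneg (v : H1 Ω)]⟩

/-! ### Stability of `Lγ` and of the penalties -/

/-- Adding and subtracting `A ustar` isolates a Lipschitz term and a fixed functional. Expanding `‖u
- v‖ ^ 2` around `ustar - v` gives a cross term, absorbed in `K₄`, and a pure square that keeps its
favourable sign. -/
theorem Lγ_sub_left_le {Cb Ms Mt : ℝ} (hCb : 0 ≤ Cb)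
    (hA : ∀ u v : H1 Ω, ‖P.A u - P.A v‖ ≤ Cb * ‖u - v‖) (ustar : H1 Ω) {u v : H1 Ω}
    (hu : ‖u‖ ≤ Ms) (hv : ‖v‖ ≤ Mt) :
    P.Lγ u v - P.Lγ ustar v ≤
      P.K₄ Cb Ms Mt ustar * ‖u - ustar‖ - 1 / (2 * P.γ) * ‖ustar - u‖ ^ 2 := by
  have hγ := P.γ_pos
  have e1 : (P.A u - P.load) (u - v) - (P.A ustar - P.load) (ustar - v)
      = (P.A u - P.A ustar) (u - v) + (P.A ustar - P.load) (u - ustar) := by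
    simp only [sub_apply, map_sub]
    ring
  have b1 : (P.A u - P.A ustar) (u - v) ≤ Cb * ‖u - ustar‖ * (Ms + Mt) :=
    ((le_abs_self _).trans ((P.A u - P.A ustar).le_opNorm (u - v))).trans <| by
      gcongr
      · exact hA u ustar
      · exact (norm_sub_le u v).trans (add_le_add hu hv)
  have b2 : (P.A ustar - P.load) (u - ustar) ≤ ‖P.A ustar - P.load‖ * ‖u - ustar‖ :=
    (le_abs_self _).trans ((P.A ustar - P.load).le_opNorm (u - ustar))
  have e3 : ‖u - v‖ ^ 2 = ‖ustar - v‖ ^ 2 + 2 * ⟪ustar - v, u - ustar⟫ + ‖u - ustar‖ ^ 2 := by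
    rw [← norm_add_sq_real]
    congr 2
    abel
  have b3 : -⟪ustar - v, u - ustar⟫ ≤ (‖ustar‖ + Mt) * ‖u - ustar‖ :=
    ((neg_le_abs _).trans (abs_real_inner_le_norm _ _)).trans <| by
      gcongr
      exact (norm_sub_le ustar v).trans (by gcongr)
  have b4 : 1 / P.γ * -⟪ustar - v, u - ustar⟫
      ≤ 1 / P.γ * ((‖ustar‖ + Mt) * ‖u - ustar‖) := by gcongr
  have e5 : 1 / (2 * P.γ) * (2 * ⟪ustar - v, u - ustar⟫)
      = 1 / P.γ * ⟪ustar - v, u - ustar⟫ := by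
    field_simp
  rw [norm_sub_rev ustar u, Lγ, Lγ, K₄, e3]
  linarith

theorem Lγ_sub_right_le {Cb Ms Mt : ℝ} (hCb : 0 ≤ Cb)
    (hA : ∀ u v : H1 Ω, ‖P.A u - P.A v‖ ≤ Cb * ‖u - v‖) {u w : H1 Ω}
    (hu : ‖u‖ ≤ Ms) (hw : ‖w‖ ≤ Mt) (v : H1 Ω) :
    P.Lγ u v - P.Lγ u w ≤ P.K₁ Cb Ms Mt * ‖w - v‖ := by
  have hγ := P.γ_pos
  have e1 : (P.A u - P.load) (u - v) - (P.A u - P.load) (u - w)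
      = (P.A u - P.load) (w - v) := by
    rw [← map_sub]
    congr 1
    abel
  -- Lipschitz continuity becomes a growth bound through `A 0 = 0`.
  have hAu : ‖P.A u - P.load‖ ≤ Cb * Ms + ‖P.load‖ := by
    refine (norm_sub_le (P.A u) P.load).trans ?_
    have h := hA u 0
    rw [P.A_zero, sub_zero, sub_zero] at h
    gcongr
    exact h.trans (by gcongr)
  have b1 : (P.A u - P.load) (w - v) ≤ (Cb * Ms + ‖P.load‖) * ‖w - v‖ :=
    ((le_abs_self _).trans ((P.A u - P.load).le_opNorm (w - v))).trans (by gcongr)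
  have e2 : ‖u - v‖ ^ 2 = ‖u - w‖ ^ 2 + 2 * ⟪u - w, w - v⟫ + ‖w - v‖ ^ 2 := by
    rw [← norm_add_sq_real]
    congr 2
    abel
  have b3 : -⟪u - w, w - v⟫ ≤ (Ms + Mt) * ‖w - v‖ :=
    ((neg_le_abs _).trans (abs_real_inner_le_norm _ _)).trans <| by
      gcongr
      exact (norm_sub_le _ _).trans (add_le_add hu hw)
  have b4 : 1 / P.γ * -⟪u - w, w - v⟫ ≤ 1 / P.γ * ((Ms + Mt) * ‖w - v‖) := by gcongr
  have e5 : 1 / (2 * P.γ) * (2 * ⟪u - w, w - v⟫) = 1 / P.γ * ⟪u - w, w - v⟫ := by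
    field_simp
  -- The pure square enters with a minus sign and is simply dropped here.
  have b6 : 0 ≤ 1 / (2 * P.γ) * ‖w - v‖ ^ 2 := by positivity
  rw [Lγ, Lγ, K₁, e2]
  linarith

/-- The penalty is quadratic in the distance to `ustar`; bounding one factor by the uniform bounds
makes it linear. With `t` the trace distance, `t ^ 2 = 2 * t ^ 2 - t ^ 2` and only `2 * t ^ 2` is
linearised: this yields the factor 2 in `K₆` and the negative square. -/
theorem R₁_le {Ms Bs : ℝ} {ustar : H1 Ω} (hs : ustar ∈ P.K) {u : H1 Ω}
    (hu : ‖u‖ ≤ Ms) (hub : ‖trace u‖ ≤ Bs) :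
    P.R₁ u ≤ P.K₅ Ms ustar * ‖val (u - ustar)‖ + P.K₆ Bs * ‖trace u - trace ustar‖
      - P.wb₁ * ‖trace u - trace ustar‖ ^ 2 := by
  have hwb := P.wb₁_nonneg
  have hwo := P.wo₁_nonneg
  have h := P.penalty_le P.wb₁ hwo hs u
  have d1 : ‖trace u - trace ustar‖ ≤ ‖P.h‖ + Bs := by
    rw [hs.2]
    linarith [norm_sub_le (trace u) P.h]
  have d2 : ‖val (u - ustar)‖ ≤ Ms + ‖ustar‖ + 2 * ‖val P.ψ‖ := by
    linarith [norm_val_le (u - ustar), norm_sub_le u ustar, norm_nonneg (val P.ψ)]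
  have m1 : P.wb₁ * (‖trace u - trace ustar‖ * ‖trace u - trace ustar‖)
      ≤ P.wb₁ * ((‖P.h‖ + Bs) * ‖trace u - trace ustar‖) := by gcongr
  have m2 : P.wo₁ * (‖val (u - ustar)‖ * ‖val (u - ustar)‖)
      ≤ P.wo₁ * ((Ms + ‖ustar‖ + 2 * ‖val P.ψ‖) * ‖val (u - ustar)‖) := by gcongr
  rw [R₁, K₅, K₆]
  linarith

theorem R₂_le {r Mt Bt : ℝ} {v : H1 Ω} (hv : v ∈ P.K) (hr : ‖val v‖ ≤ r) {w : H1 Ω}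
    (hw : ‖w‖ ≤ Mt) (hwb : ‖trace w‖ ≤ Bt) :
    P.R₂ w ≤ P.K₂ r Mt * ‖val (w - v)‖ + P.K₃ Bt * ‖trace w - trace v‖ := by
  have hwb₂ := P.wb₂_nonneg
  have hwo := P.wo₂_nonneg
  have h := P.penalty_le P.wb₂ hwo hv w
  have d1 : ‖trace w - trace v‖ ≤ 2 * (‖P.h‖ + Bt) := by
    rw [hv.2]
    linarith [norm_sub_le (trace w) P.h, norm_nonneg P.h, norm_nonneg (trace w)]
  -- The `ψ` term is slack: comparison with a feasible `v` already removes the obstacle.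
  have d2 : ‖val (w - v)‖ ≤ r + Mt + 2 * ‖val P.ψ‖ := by
    rw [map_sub]
    linarith [norm_val_le w, norm_sub_le (val w) (val v), norm_nonneg (val P.ψ)]
  have m1 : P.wb₂ * (‖trace w - trace v‖ * ‖trace w - trace v‖)
      ≤ P.wb₂ * (2 * (‖P.h‖ + Bt) * ‖trace w - trace v‖) := by gcongr
  have m2 : P.wo₂ * (‖val (w - v)‖ * ‖val (w - v)‖)
      ≤ P.wo₂ * ((r + Mt + 2 * ‖val P.ψ‖) * ‖val (w - v)‖) := by gcongr
  rw [R₂, K₂, K₃]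
  linarith

/-- Stability of the penalised gap function `H_γ` at a feasible point. -/
theorem H_sub_le {Cb Ms Bs Mt : ℝ} (hCb : 0 ≤ Cb)
    (hA : ∀ u v : H1 Ω, ‖P.A u - P.A v‖ ≤ Cb * ‖u - v‖) {ustar : H1 Ω} (hs : ustar ∈ P.K)
    {Xt : Set (H1 Ω)} (hne : Xt.Nonempty) (hXt : ∀ v ∈ Xt, ‖v‖ ≤ Mt) {u : H1 Ω}
    (hu : ‖u‖ ≤ Ms) (hub : ‖trace u‖ ≤ Bs) :
    P.H Xt u - P.H Xt ustar ≤
      P.K₄ Cb Ms Mt ustar * ‖u - ustar‖ + P.K₅ Ms ustar * ‖val (u - ustar)‖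
        + P.K₆ Bs * ‖trace u - trace ustar‖ - P.wb₁ * ‖trace u - trace ustar‖ ^ 2
        - 1 / (2 * P.γ) * ‖ustar - u‖ ^ 2 := by
  have : Nonempty Xt := hne.to_subtype
  rw [sub_le_iff_le_add]
  refine ciSup_le fun v => ?_
  have h1 := P.Lγ_sub_left_le hCb hA ustar hu (hXt v v.2)
  have h2 := P.R₁_le hs hu hub
  have h3 : _ ≤ P.H Xt ustar := le_ciSup (P.bddAbove_H Xt ustar) v
  rw [P.R₁_eq_zero hs] at h3
  linarith

/-! ### Gap function and coercivity -/

/-- The variational inequality makes every competitor nonpositive, and `v = ustar` attains zero. -/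
theorem G_eq_zero {ustar : H1 Ω} (hs : P.SolvesVI ustar) {Y : Set (H1 Ω)} (hY : ustar ∈ Y) :
    P.G Y ustar = 0 := by
  have hγ := P.γ_pos
  have : Nonempty (P.K ∩ Y : Set (H1 Ω)) := ⟨⟨ustar, hs.1, hY⟩⟩
  refine le_antisymm (ciSup_le fun v => ?_) ?_
  · have h1 := hs.2 v v.2.1
    have h2 : 0 ≤ 1 / (2 * P.γ) * ‖ustar - v‖ ^ 2 := by positivity
    rw [Lγ]
    linarith
  · have h := le_ciSup (P.bddAbove_Lγ (P.K ∩ Y) ustar) ⟨ustar, hs.1, hY⟩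
    have e : P.Lγ ustar ustar = 0 := by simp [Lγ]
    exact e.symm.le.trans h

/-- Coercivity bounds the error by the gap function. -/
theorem coercive_le_G {Ca : ℝ} {ustar u : H1 Ω}
    (hCa : Ca * ‖u - ustar‖ ^ 2 ≤ (P.A u - P.A ustar) (u - ustar)) {Y : Set (H1 Ω)}
    (hs : ustar ∈ P.K ∩ Y) :
    (Ca - 1 / (2 * P.γ)) * ‖u - ustar‖ ^ 2 ≤
      P.G Y u + (P.A ustar - P.load) (ustar - u) := by
  have h : P.Lγ u ustar ≤ P.G Y u := le_ciSup (P.bddAbove_Lγ (P.K ∩ Y) u) ⟨ustar, hs⟩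
  have e : (P.A u - P.A ustar) (u - ustar)
      = (P.A u - P.load) (u - ustar) + (P.A ustar - P.load) (ustar - u) := by
    simp only [sub_apply, map_sub]
    ring
  rw [Lγ] at h
  linarith

/-! ### Signs of the constants -/

theorem K₁_nonneg {Cb Ms Mt : ℝ} (hCb : 0 ≤ Cb) (hMs : 0 ≤ Ms) (hMt : 0 ≤ Mt) :
    0 ≤ P.K₁ Cb Ms Mt := by
  have := P.γ_pos
  rw [K₁]
  positivity

theorem K₂_nonneg {r Mt : ℝ} (hr : 0 ≤ r) (hMt : 0 ≤ Mt) : 0 ≤ P.K₂ r Mt := by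
  have := P.wo₂_nonneg
  rw [K₂]
  positivity

theorem K₃_nonneg {Bt : ℝ} (hBt : 0 ≤ Bt) : 0 ≤ P.K₃ Bt := by
  have := P.wb₂_nonneg
  rw [K₃]
  positivity

theorem K₄_nonneg {Cb Ms Mt : ℝ} (hCb : 0 ≤ Cb) (hMs : 0 ≤ Ms) (hMt : 0 ≤ Mt) (ustar : H1 Ω) :
    0 ≤ P.K₄ Cb Ms Mt ustar := by
  have := P.γ_pos
  rw [K₄]
  positivity

theorem K₅_nonneg {Ms : ℝ} (hMs : 0 ≤ Ms) (ustar : H1 Ω) : 0 ≤ P.K₅ Ms ustar := by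
  have := P.wo₁_nonneg
  rw [K₅]
  positivity

theorem K₆_nonneg {Bs : ℝ} (hBs : 0 ≤ Bs) : 0 ≤ P.K₆ Bs := by
  have := P.wb₁_nonneg
  rw [K₆]
  positivity

end ProblemData

namespace Collocation

variable {n : ℕ} {Ω : Set (Euc n)} {P : ProblemData Ω} (D : Collocation P)

/-! ### The discrete gap function -/

theorem hatR₂_nonneg (v : C1Closure Ω) : 0 ≤ D.hatR₂ v := by
  have := P.wb₂_nonneg
  have := P.wo₂_nonneg
  rw [hatR₂, hatLb, hatLo]
  positivity

/-- At each collocation point the square is completed twice, in the gradient difference and in the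
value difference; the right side no longer involves `v`. -/
theorem hatLγ_le (u v : C1Closure Ω) :
    D.hatLγ u v ≤ volume.real Ω / D.N * ∑ i, (P.γ / 2 * ‖u.gradient (D.x i)‖ ^ 2
      + P.γ / 2 * ((∑ j, P.b j * u.gradient (D.x i) j) + P.k * u.toFun (D.x i)
          - D.f (D.x i)) ^ 2) := by
  have e : volume.real Ω / (2 * P.γ * D.N) = volume.real Ω / D.N * (1 / (2 * P.γ)) := by
    rw [div_mul_div_comm, mul_one, mul_comm (D.N : ℝ)]
  rw [hatLγ, hatL, e, mul_assoc, ← mul_sub, ← mul_sub, Finset.mul_sum,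
    ← Finset.sum_sub_distrib, ← Finset.sum_sub_distrib]
  refine mul_le_mul_of_nonneg_left (Finset.sum_le_sum fun i _ => ?_) (by positivity)
  have h1 := real_inner_le_norm (u.gradient (D.x i)) (u.gradient (D.x i) - v.gradient (D.x i))
  have h2 := ProblemData.linear_sub_sq_le P.γ_pos ‖u.gradient (D.x i)‖
    ‖u.gradient (D.x i) - v.gradient (D.x i)‖
  have h3 := ProblemData.linear_sub_sq_le P.γ_pos
    ((∑ j, P.b j * u.gradient (D.x i) j) + P.k * u.toFun (D.x i) - D.f (D.x i))
    (u.toFun (D.x i) - v.toFun (D.x i))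
  linarith

theorem bddAbove_hatG (Xt : Set (C1Closure Ω)) (u : C1Closure Ω) :
    BddAbove (Set.range fun v : Xt => D.hatLγ u v + D.hatR₁ u - D.hatR₂ v) :=
  ⟨_, Set.forall_mem_range.2 fun v =>
    (sub_le_self _ (D.hatR₂_nonneg v)).trans (add_le_add_left (D.hatLγ_le u v) (D.hatR₁ u))⟩

/-- The gap functions `H_γ` and `Ĝ_γ` differ by at most the uniform quadrature error. -/
theorem abs_H_sub_hatG_le (hΩ : IsBoundedLipschitzDomain Ω) {Xt : Set (C1Closure Ω)}
    (hne : Xt.Nonempty) {u : C1Closure Ω} {s : ℝ}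
    (hs : ∀ v ∈ Xt, |P.Lγ (u.toH1 hΩ) (v.toH1 hΩ) + P.R₁ (u.toH1 hΩ) - P.R₂ (v.toH1 hΩ)
      - (D.hatLγ u v + D.hatR₁ u - D.hatR₂ v)| ≤ s) :
    |P.H (C1Closure.toH1 hΩ '' Xt) (u.toH1 hΩ) - D.hatG Xt u| ≤ s := by
  have : Nonempty Xt := hne.to_subtype
  have : Nonempty (C1Closure.toH1 hΩ '' Xt) := (hne.image _).to_subtype
  rw [abs_sub_le_iff]
  constructor <;> rw [sub_le_iff_le_add] <;> refine ciSup_le ?_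
  · rintro ⟨_, v, hv, rfl⟩
    have h : _ ≤ D.hatG Xt u := le_ciSup (D.bddAbove_hatG Xt u) ⟨v, hv⟩
    have := (abs_sub_le_iff.1 (hs v hv)).1
    linarith
  · rintro ⟨v, hv⟩
    have h : _ ≤ P.H (C1Closure.toH1 hΩ '' Xt) (u.toH1 hΩ) :=
      le_ciSup (P.bddAbove_H _ (u.toH1 hΩ)) ⟨_, Set.mem_image_of_mem _ hv⟩
    have := (abs_sub_le_iff.1 (hs v hv)).2
    linarith

end Collocation

/-! ### Passage to extended reals and assembly -/

/-- Nonnegativity excludes `⊤ + ⊥`, so an infinite `T` or `S` makes the claim trivial and only the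
real inequality remains. -/
theorem coe_le_add_add_two_mul_add {T I S : EReal} {x c : ℝ} (hT : 0 ≤ T) (hI : 0 ≤ I)
    (hI' : I ≠ ⊤) (hS : 0 ≤ S)
    (h : ∀ t i s : ℝ, T = t → I = i → S = s → x ≤ t + i + 2 * s + c) :
    (x : EReal) ≤ T + I + 2 * S + (c : EReal) := by
  have hbot : ∀ {y : EReal}, 0 ≤ y → y ≠ ⊥ := fun hy => ne_bot_of_le_ne_bot EReal.zero_ne_bot hy
  have h2S : 0 ≤ 2 * S := mul_nonneg (by norm_num) hS
  by_cases hTtop : T = ⊤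
  · rw [hTtop, EReal.top_add_of_ne_bot (hbot hI), EReal.top_add_of_ne_bot (hbot h2S),
      EReal.top_add_coe]
    exact le_top
  by_cases hStop : S = ⊤
  · rw [hStop, EReal.mul_top_of_pos (by norm_num),
      EReal.add_top_of_ne_bot (hbot (add_nonneg hT hI)), EReal.top_add_coe]
    exact le_top
  lift T to ℝ using ⟨hTtop, hbot hT⟩ with t
  lift S to ℝ using ⟨hStop, hbot hS⟩ with s
  lift I to ℝ using ⟨hI', hbot hI⟩ with i
  have e : (2 : EReal) * (s : EReal) = ((2 * s : ℝ) : EReal) := by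
    rw [EReal.coe_mul]
    rfl
  rw [e, ← EReal.coe_add, ← EReal.coe_add, ← EReal.coe_add, EReal.coe_le_coe_iff]
  exact h t i s rfl rfl rfl

end ObstacleVI

theorem mainTheorem11 {n : ℕ} (hn : 0 < n) {Ω : Set (Euc n)}
    (hΩ : IsBoundedLipschitzDomain Ω) (P : ProblemData Ω)
    -- a solution of the variational inequality
    (ustar : H1 Ω) (hustar : P.SolvesVI ustar)
    -- Lipschitz constant of the operator
    (Cb : ℝ) (hCb : 0 < Cb) (hA_lip : ∀ u v : H1 Ω, ‖P.A u - P.A v‖ ≤ Cb * ‖u - v‖)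
    -- uniform bounds of the solution and test classes
    (Ms Bs Mt Bt : ℝ) (hMs : 0 < Ms) (hBs : 0 < Bs) (hMt : 0 < Mt) (hBt : 0 < Bt) :
    -- the estimate on IV, for arbitrary solution and test classes in `H¹(Ω)`
    (∀ Xs Xt : Set (H1 Ω), Xt.Nonempty → UniformBound Xs Ms Bs → UniformBound Xt Mt Bt →
      (∀ u : H1 Ω, BddAbove (Set.range fun v : Xt => P.Lγ u v + P.R₁ u - P.R₂ v)) ∧
      ∀ ubar ∈ Xs,
        P.H Xt ubar - P.H Xt ustar ≤
          P.K₄ Cb Ms Mt ustar * ‖ubar - ustar‖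
            + P.K₅ Ms ustar * ‖val (ubar - ustar)‖
            + P.K₆ Bs * ‖trace ubar - trace ustar‖
            - P.wb₁ * ‖trace ubar - trace ustar‖ ^ 2
            - 1 / (2 * P.γ) * ‖ustar - ubar‖ ^ 2) ∧
    -- the full error decomposition, for classes of `C¹(Ω̄)` functions
    (∀ (Ca : ℝ), 0 < Ca →
      (∀ u v : H1 Ω, Ca * ‖u - v‖ ^ 2 ≤ (P.A u - P.A v) (u - v)) →
      ∀ (Y : Set (H1 Ω)) (r : ℝ), ustar ∈ Y → (∀ v ∈ P.K ∩ Y, ‖val v‖ ≤ r) →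
      ∀ (D : Collocation P) (Xs Xt : Set (C1Closure Ω)), Xt.Nonempty →
      UniformBound (C1Closure.toH1 hΩ '' Xs) Ms Bs →
      UniformBound (C1Closure.toH1 hΩ '' Xt) Mt Bt →
      (∀ u : H1 Ω, BddAbove (Set.range fun v : (P.K ∩ Y : Set (H1 Ω)) => P.Lγ u v)) ∧
      (∀ u : C1Closure Ω,
        BddAbove (Set.range fun v : Xt => D.hatLγ u v + D.hatR₁ u - D.hatR₂ v)) ∧
      -- `uhat` is an exact solution of the discrete problem, `uA` any computed candidate
      ∀ uhat ∈ Xs, (∀ u ∈ Xs, D.hatG Xt uhat ≤ D.hatG Xt u) → ∀ uA ∈ Xs,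
        (((Ca - 1 / (2 * P.γ)) * ‖uA.toH1 hΩ - ustar‖ ^ 2 : ℝ) : EReal) ≤
          (⨆ v ∈ P.K ∩ Y, ⨅ w ∈ Xt,
            ((P.K₁ Cb Ms Mt * ‖w.toH1 hΩ - v‖
              + P.K₂ r Mt * ‖val (w.toH1 hΩ - v)‖
              + P.K₃ Bt * ‖trace (w.toH1 hΩ) - trace v‖ : ℝ) : EReal))
          + (⨅ u ∈ Xs,
            ((P.K₄ Cb Ms Mt ustar * ‖u.toH1 hΩ - ustar‖
              + P.K₅ Ms ustar * ‖val (u.toH1 hΩ - ustar)‖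
              + P.K₆ Bs * ‖trace (u.toH1 hΩ) - trace ustar‖ : ℝ) : EReal))
          + 2 * (⨆ u ∈ Xs, ⨆ v ∈ Xt,
            ((|P.Lγ (u.toH1 hΩ) (v.toH1 hΩ) + P.R₁ (u.toH1 hΩ) - P.R₂ (v.toH1 hΩ)
              - (D.hatLγ u v + D.hatR₁ u - D.hatR₂ v)| : ℝ) : EReal))
          + ((D.hatG Xt uA - D.hatG Xt uhat
              + (P.H (C1Closure.toH1 hΩ '' Xt) ustar - P.G Y ustar)
              + (P.A ustar - P.load) (ustar - uA.toH1 hΩ)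
              - P.R₁ (uA.toH1 hΩ) : ℝ) : EReal)) := by
  have hCb0 := hCb.le
  refine ⟨fun Xs Xt hne hXs hXt => ⟨P.bddAbove_H Xt, fun u hu =>
    P.H_sub_le hCb0 hA_lip hustar.1 hne (fun v hv => (hXt v hv).1) (hXs u hu).1 (hXs u hu).2⟩, ?_⟩
  intro Ca _ hcoer Y r hY hr D Xs Xt hne hXs hXt
  refine ⟨P.bddAbove_Lγ _, D.bddAbove_hatG Xt, fun uhat huhat hmin uA huA => ?_⟩
  obtain ⟨hXs1, hXs2⟩ : (∀ u ∈ Xs, ‖u.toH1 hΩ‖ ≤ Ms) ∧ ∀ u ∈ Xs, ‖trace (u.toH1 hΩ)‖ ≤ Bs :=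
    ⟨fun u hu => (hXs _ (Set.mem_image_of_mem _ hu)).1,
      fun u hu => (hXs _ (Set.mem_image_of_mem _ hu)).2⟩
  obtain ⟨hXt1, hXt2⟩ : (∀ u ∈ Xt, ‖u.toH1 hΩ‖ ≤ Mt) ∧ ∀ u ∈ Xt, ‖trace (u.toH1 hΩ)‖ ≤ Bt :=
    ⟨fun u hu => (hXt _ (Set.mem_image_of_mem _ hu)).1,
      fun u hu => (hXt _ (Set.mem_image_of_mem _ hu)).2⟩
  have hsKY : ustar ∈ P.K ∩ Y := ⟨hustar.1, hY⟩
  have hr0 : 0 ≤ r := (norm_nonneg _).trans (hr ustar hsKY)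
  have k1 := P.K₁_nonneg hCb0 hMs.le hMt.le
  have k2 := P.K₂_nonneg hr0 hMt.le
  have k3 := P.K₃_nonneg hBt.le
  have k4 := P.K₄_nonneg hCb0 hMs.le hMt.le ustar
  have k5 := P.K₅_nonneg hMs.le ustar
  have k6 := P.K₆_nonneg hBs.le
  have k0T : ∀ v w : H1 Ω, 0 ≤ P.K₁ Cb Ms Mt * ‖w - v‖ + P.K₂ r Mt * ‖val (w - v)‖
      + P.K₃ Bt * ‖trace w - trace v‖ := fun v w => by positivity
  have k0I : ∀ u : H1 Ω, 0 ≤ P.K₄ Cb Ms Mt ustar * ‖u - ustar‖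
      + P.K₅ Ms ustar * ‖val (u - ustar)‖ + P.K₆ Bs * ‖trace u - trace ustar‖ :=
    fun u => by positivity
  -- The suprema are nonnegative because their index sets contain `ustar`, respectively `uA` and
  -- some test function; the infimum is finite because `uA` competes in it.
  refine coe_le_add_add_two_mul_add
    (le_trans (le_iInf₂ fun w _ => EReal.coe_nonneg.2 (k0T ustar _))
      (le_iSup₂_of_le ustar hsKY le_rfl))
    (le_iInf₂ fun u _ => EReal.coe_nonneg.2 (k0I _))
    (ne_top_of_le_ne_top (EReal.coe_ne_top _) (iInf₂_le uA huA))
    (le_trans (EReal.coe_nonneg.2 (abs_nonneg _))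
      (le_iSup₂_of_le uA huA (le_iSup₂_of_le hne.some hne.some_mem le_rfl)))
    fun t i s hT hI hS => ?_
  have hTv : ∀ v ∈ P.K ∩ Y, P.Lγ (uA.toH1 hΩ) v - P.H (C1Closure.toH1 hΩ '' Xt) (uA.toH1 hΩ)
      + P.R₁ (uA.toH1 hΩ) ≤ t := by
    intro v hv
    -- No minimising `w` is needed: each `w` gives `H uA ≥ Lγ uA w + R₁ uA - R₂ w`, so the left side
    -- is a lower bound for the infimum.
    refine EReal.coe_le_coe_iff.1 (le_trans (le_iInf₂ fun w hw => EReal.coe_le_coe_iff.2 ?_)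
      ((le_iSup₂_of_le v hv le_rfl).trans_eq hT))
    have h1 := P.Lγ_sub_right_le hCb0 hA_lip (hXs1 uA huA) (hXt1 w hw) v
    have h2 := P.R₂_le hv.1 (hr v hv) (hXt1 w hw) (hXt2 w hw)
    have h3 : _ ≤ P.H (C1Closure.toH1 hΩ '' Xt) (uA.toH1 hΩ) :=
      le_ciSup (P.bddAbove_H _ (uA.toH1 hΩ)) ⟨_, Set.mem_image_of_mem _ hw⟩
    linarith
  have hquad : ∀ u ∈ Xs,
      |P.H (C1Closure.toH1 hΩ '' Xt) (u.toH1 hΩ) - D.hatG Xt u| ≤ s := fun u hu =>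
    D.abs_H_sub_hatG_le hΩ hne fun v hv => by
      refine EReal.coe_le_coe_iff.1 (le_trans ?_ hS.le)
      refine le_iSup₂_of_le u hu ?_
      refine le_iSup₂_of_le v hv ?_
      exact le_rfl
  have hG : P.G Y (uA.toH1 hΩ)
      ≤ t + P.H (C1Closure.toH1 hΩ '' Xt) (uA.toH1 hΩ) - P.R₁ (uA.toH1 hΩ) := by
    have : Nonempty (P.K ∩ Y : Set (H1 Ω)) := ⟨⟨ustar, hsKY⟩⟩
    refine ciSup_le fun v => ?_
    linarith [hTv v v.2]
  have hG0 := P.G_eq_zero hustar hY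
  have hmain := P.coercive_le_G (hcoer (uA.toH1 hΩ) ustar) hsKY
  have hA := (abs_sub_le_iff.1 (hquad uA huA)).1
  -- Isolating `i` turns the goal into a lower bound for an infimum, to be checked at an arbitrary
  -- `u ∈ Xs`.
  rw [← sub_le_iff_le_add, ← sub_le_iff_le_add, ← sub_le_iff_le_add']
  refine EReal.coe_le_coe_iff.1
    (le_trans (le_iInf₂ fun u hu => EReal.coe_le_coe_iff.2 ?_) hI.le)
  have h1 := (abs_sub_le_iff.1 (hquad u hu)).2
  have h2 := hmin u hu
  have h3 := P.H_sub_le hCb0 hA_lip hustar.1 (hne.image (C1Closure.toH1 hΩ))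
    (fun v hv => (hXt v hv).1) (hXs1 u hu) (hXs2 u hu)
  have hwb := P.wb₁_nonneg
  have hγ := P.γ_pos
  -- The negative squares in the estimate on `H` are discarded here.
  have p1 : 0 ≤ P.wb₁ * ‖trace (u.toH1 hΩ) - trace ustar‖ ^ 2 := by positivity
  have p2 : 0 ≤ 1 / (2 * P.γ) * ‖ustar - u.toH1 hΩ‖ ^ 2 := by positivity
  linarith
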